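/- **Definitions.** All matrices are complex; $\circ$ is the entrywise (Schur) product, $M^{(-)}$ the entrywise inverse of a matrix $M$ without zero entries, and $e_i$ the $i$-th standard basis vector. For $n\times n$ matrices $A,B$ let $X_A(M)=AM$ and $\Delta_B(M)=B\circ M$ on the space of $n\times n$ matrices. $(A,B)$ is a *one-sided Jones pair* if $X_A\Delta_BX_A=\Delta_BX_A\Delta_B$, and a *Jones pair* if both $(A,B)$ and $(A,B^T)$ are one-sided Jones pairs. A Jones pair is *invertible* if $A$ and $B$ are invertible matrices and $B$ has no zero entry (then $A$ has no zero entry either). For a square matrix $A$ without zero entries, the *Nomura algebra* $\mathcal N_A$ is the set of the matrices $M$ such that $Ae_i\circ A^{(-)}e_j$ is an eigenvector of $M$ for all $i,j$. An *association scheme* on a finite set $V$ is a finite set $\mathcal A$ of non-zero $01$-matrices indexed by $V\times V$ that contains $I$, sums to the all-ones matrix $J$, is closed under transposition, and whose members commute pairwise and have their products in the span of $\mathcal A$; this span is its *Bose–Mesner algebra*, and it determines $\mathcal A$. For a non-empty $Y\subseteq V$ let $M_Y$ be the submatrix of $M$ with rows and columns in $Y$, and $\mathcal A_Y$ the set of the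 non-zero matrices among the $M_Y$, $M\in\mathcal A$. If $\mathcal A_Y$ is an association scheme, it is called the *induced scheme* of $\mathcal A$ on $Y$. **Theorem.** Let $n\ge 1$ and let $(A,B)$ be an invertible Jones pair of $n\times n$ matrices. Then there is an invertible diagonal matrix $C$ with $A^T=C^{-2}AC^2$, and for every such $C$ the following holds for the $2n\times 2n$ matrix $$W=\begin{pmatrix}A^T&-A^T\\ (B^{(-)})^TC&(B^{(-)})^TC\end{pmatrix}.$$ $\mathcal N_W$ is the Bose–Mesner algebra of an association scheme $\mathcal A$ on $\{1,\dots,2n\}$, $\mathcal N_A$ is the Bose–Mesner algebra of an association scheme $\mathcal B$ on $\{1,\dots,n\}$, and $\mathcal B$ is the induced scheme of $\mathcal A$ on $Y=\{1,\dots,n\}$, that is, $\mathcal B=\mathcal A_Y$. -/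

import Mathlib

namespace JonesPairs

open Matrix

/-- The Schur inverse `A⁽⁻⁾`, the entrywise inverse of a matrix. -/
noncomputable def schurInv {m n : Type*} (A : Matrix m n ℂ) : Matrix m n ℂ :=
  Matrix.of fun i j => (A i j)⁻¹

/-- A matrix is Schur invertible if it has no zero entry. -/
def IsSchurInvertible {m n : Type*} (A : Matrix m n ℂ) : Prop :=
  ∀ i j, A i j ≠ 0

section JonesPair

variable {n : Type*} [Fintype n]

/-- The endomorphism `X_A : M ↦ A M` of the space of square matrices. -/
def X (A : Matrix n n ℂ) (M : Matrix n n ℂ) : Matrix n n ℂ := A * M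

/-- The endomorphism `Δ_B : M ↦ B ∘ M` (Schur product) of the space of square matrices. -/
def Delta (B : Matrix n n ℂ) (M : Matrix n n ℂ) : Matrix n n ℂ := B ⊙ M

/-- `(A, B)` is a one-sided Jones pair if `X_A Δ_B X_A = Δ_B X_A Δ_B`. -/
def IsOneSidedJonesPair (A B : Matrix n n ℂ) : Prop :=
  X A ∘ Delta B ∘ X A = Delta B ∘ X A ∘ Delta B

/-- `(A, B)` is a Jones pair if `(A, B)` and `(A, Bᵀ)` are one-sided Jones pairs. -/
def IsJonesPair (A B : Matrix n n ℂ) : Prop :=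
  IsOneSidedJonesPair A B ∧ IsOneSidedJonesPair A Bᵀ

/-- An invertible Jones pair: `X_A` and `Δ_B` are invertible, that is, `A` is invertible and `B` is
Schur invertible, and moreover `B` is an invertible matrix. The last condition excludes degenerate
pairs such as `(I, J)`; together these conditions force `A` to be Schur invertible too. -/
structure IsInvertibleJonesPair [DecidableEq n] (A B : Matrix n n ℂ) : Prop where
  isJonesPair : IsJonesPair A B
  isUnit_left : IsUnit A
  schurInvertible_right : IsSchurInvertible B
  isUnit_right : IsUnit B

/-- The space `N_{A,B}` of the matrices that have all the vectors `A e_i ∘ B e_j`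
as eigenvectors. -/
def nomuraPair (A B : Matrix n n ℂ) : Submodule ℂ (Matrix n n ℂ) where
  carrier := {M | ∀ i j, ∃ μ : ℂ, M *ᵥ (fun k => A k i * B k j) = μ • fun k => A k i * B k j}
  zero_mem' := fun i j => ⟨0, by simp⟩
  add_mem' := by
    intro M N hM hN i j
    obtain ⟨μ, hμ⟩ := hM i j
    obtain ⟨ν, hν⟩ := hN i j
    exact ⟨μ + ν, by rw [Matrix.add_mulVec, hμ, hν, add_smul]⟩
  smul_mem' := by
    intro c M hM i j
    obtain ⟨μ, hμ⟩ := hM i j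
    exact ⟨c * μ, by rw [Matrix.smul_mulVec, hμ, mul_smul]⟩

/-- The Nomura algebra `N_A` of the matrices that have all the vectors `A e_i ∘ A⁽⁻⁾ e_j`
as eigenvectors. -/
noncomputable def nomura (A : Matrix n n ℂ) : Submodule ℂ (Matrix n n ℂ) :=
  nomuraPair A (schurInv A)

end JonesPair

section W

variable {n : Type*} [Fintype n] [DecidableEq n]

/-- `C = diag(c)` is an invertible diagonal matrix with `Aᵀ = C⁻² A C²`. -/
def IsSymmetrizer (A : Matrix n n ℂ) (c : n → ℂ) : Prop :=
  (∀ i, c i ≠ 0) ∧ Aᵀ = (diagonal c ^ 2)⁻¹ * A * diagonal c ^ 2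

/-- The matrix `W` with first block row `(Aᵀ, -Aᵀ)` and second block row
`(B⁽⁻⁾ᵀ C, B⁽⁻⁾ᵀ C)`, where `C = diag(c)`. -/
noncomputable def matrixW (A B : Matrix n n ℂ) (c : n → ℂ) : Matrix (n ⊕ n) (n ⊕ n) ℂ :=
  fromBlocks Aᵀ (-Aᵀ) ((schurInv B)ᵀ * diagonal c) ((schurInv B)ᵀ * diagonal c)

end W

/-- A (commutative) association scheme on a finite set `V`, given by the set of its adjacency
matrices. -/
structure IsAssociationScheme {V : Type*} [Fintype V] [DecidableEq V]
    (𝒜 : Finset (Matrix V V ℂ)) : Prop where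
  zero_one : ∀ M ∈ 𝒜, ∀ x y, M x y = 0 ∨ M x y = 1
  zero_notMem : (0 : Matrix V V ℂ) ∉ 𝒜
  one_mem : (1 : Matrix V V ℂ) ∈ 𝒜
  sum_eq : ∑ M ∈ 𝒜, M = Matrix.of fun _ _ => 1
  transpose_mem : ∀ M ∈ 𝒜, Mᵀ ∈ 𝒜
  mul_comm : ∀ M ∈ 𝒜, ∀ N ∈ 𝒜, M * N = N * M
  mul_mem_span : ∀ M ∈ 𝒜, ∀ N ∈ 𝒜, M * N ∈ Submodule.span ℂ (𝒜 : Set (Matrix V V ℂ))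

/-- `𝒜` is an association scheme and its Bose-Mesner algebra, the span of `𝒜`, is `𝒩`. Such an `𝒜`
is determined by `𝒩`: it is the basis of Schur idempotents of `𝒩`. -/
def IsSchemeOf {V : Type*} [Fintype V] [DecidableEq V] (𝒜 : Finset (Matrix V V ℂ))
    (𝒩 : Submodule ℂ (Matrix V V ℂ)) : Prop :=
  IsAssociationScheme 𝒜 ∧ Submodule.span ℂ (𝒜 : Set (Matrix V V ℂ)) = 𝒩

open Classical in
/-- The set `𝒜_Y` of the matrices `M_Y`, `M ∈ 𝒜`, obtained from the rows and the columns indexed by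
the subset `Y` of `V`, which is given by an injection into `V`. A class of `𝒜` without a pair in
`Y × Y` is dropped (its restriction is the zero matrix). -/
noncomputable def restrictScheme {V Y : Type*} (f : Y ↪ V) (𝒜 : Finset (Matrix V V ℂ)) :
    Finset (Matrix Y Y ℂ) :=
  (𝒜.image fun M => M.submatrix f f).filter fun N => N ≠ 0

/-- `ℬ` is the scheme induced by the association scheme `𝒜` on the nonempty subset `Y`. -/
def IsInducedScheme {V Y : Type*} [Fintype V] [DecidableEq V] [Fintype Y] [DecidableEq Y]
    (f : Y ↪ V) (ℬ : Finset (Matrix Y Y ℂ)) (𝒜 : Finset (Matrix V V ℂ)) : Prop :=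
  Nonempty Y ∧ IsAssociationScheme 𝒜 ∧ IsAssociationScheme ℬ ∧ restrictScheme f 𝒜 = ℬ

end JonesPairs

/-! Evaluated on matrices with equal columns, the one-sided Jones relation says that $A(Ae_i\circ
Be_j)=B_{ij}(Ae_i\circ Be_j)$, so $A\in\mathcal N_{A,B}$ with eigenvalue matrix $B$. This forces $A$
and $B$ to be type II (`HasEigenmatrix.isTypeII_left`, `HasEigenmatrix.isTypeII_right`) and
$A_{im}/A_{mi}$ to have the form $c_i^2/c_m^2$, which gives $C$ and, as rescaling rows and columns
preserves Nomura algebras, $\mathcal N_{A^T}=\mathcal N_A$. For a type II matrix the Nomura algebra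
is a Bose–Mesner algebra.

The exchange rule $\mathcal N_{A,B}\circ\mathcal N_{B^{(-)},C}\subseteq\mathcal N_{A,C}$ gives
$\mathcal N_A\subseteq\mathcal N_B$ (`HasEigenmatrix.nomura_le`). Passing to eigenvalue matrices,
every $P\in\mathcal N_{A^T}$ acquires a partner $S\in\mathcal N_{(B^{(-)})^T}$ with the same
eigenvalues, and $P\oplus S\in\mathcal N_W$. Conversely the signs in $W$ isolate the upper left
block, so restriction to $Y$ maps $\mathcal N_W$ onto $\mathcal N_{A^T}=\mathcal N_A$. Restricted
classes always partition $Y\times Y$ and span the restricted algebra; as that algebra is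
Bose–Mesner, they form its scheme. -/

namespace JonesPairs

open Matrix

/-! ### Type II matrices. -/

section TypeII

variable {n : Type*} [Fintype n] [DecidableEq n]

/-- A type II matrix: a matrix without zero entries with `A (A⁽⁻⁾)ᵀ = |n| I`. -/
def IsTypeII (A : Matrix n n ℂ) : Prop :=
  IsSchurInvertible A ∧ A * (schurInv A)ᵀ = (Fintype.card n : ℂ) • 1

omit [Fintype n] [DecidableEq n] in
theorem schurInv_schurInv (A : Matrix n n ℂ) : schurInv (schurInv A) = A := by
  ext i j; simp [schurInv]

omit [Fintype n] [DecidableEq n] in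
theorem schurInv_transpose (A : Matrix n n ℂ) : schurInv Aᵀ = (schurInv A)ᵀ := rfl

omit [Fintype n] [DecidableEq n] in
@[simp]
theorem schurInv_apply (A : Matrix n n ℂ) (i j : n) : schurInv A i j = (A i j)⁻¹ := rfl

omit [Fintype n] [DecidableEq n] in
theorem IsSchurInvertible.schurInv {A : Matrix n n ℂ} (hA : IsSchurInvertible A) :
    IsSchurInvertible (schurInv A) := fun i j => inv_ne_zero (hA i j)

theorem IsTypeII.transpose_schurInv_mul {A : Matrix n n ℂ} (hA : IsTypeII A) :
    (JonesPairs.schurInv A)ᵀ * A = (Fintype.card n : ℂ) • 1 := by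
  rcases isEmpty_or_nonempty n with h | h
  · ext i; exact isEmptyElim i
  have hn : (Fintype.card n : ℂ) ≠ 0 := by exact_mod_cast Fintype.card_ne_zero
  have h1 : A * ((Fintype.card n : ℂ)⁻¹ • (JonesPairs.schurInv A)ᵀ) = 1 := by
    rw [Matrix.mul_smul, hA.2, smul_smul, inv_mul_cancel₀ hn, one_smul]
  rw [mul_eq_one_comm, Matrix.smul_mul] at h1
  rw [← h1, smul_smul, mul_inv_cancel₀ hn, one_smul]

theorem IsTypeII.transpose {A : Matrix n n ℂ} (hA : IsTypeII A) : IsTypeII Aᵀ := by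
  refine ⟨fun i j => hA.1 j i, ?_⟩
  have h := congrArg Matrix.transpose hA.transpose_schurInv_mul
  simpa [Matrix.transpose_mul, schurInv_transpose] using h

theorem IsTypeII.schurInv {A : Matrix n n ℂ} (hA : IsTypeII A) : IsTypeII (schurInv A) := by
  refine ⟨hA.1.schurInv, ?_⟩
  have h := congrArg Matrix.transpose hA.2
  simpa [Matrix.transpose_mul, schurInv_schurInv] using h

theorem IsTypeII.sum_row {A : Matrix n n ℂ} (hA : IsTypeII A) (i j : n) :
    ∑ k, A i k * (A j k)⁻¹ = if i = j then (Fintype.card n : ℂ) else 0 := by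
  have h := congrFun (congrFun hA.2 i) j
  simpa [Matrix.mul_apply, Matrix.one_apply] using h

theorem IsTypeII.sum_col {A : Matrix n n ℂ} (hA : IsTypeII A) (i j : n) :
    ∑ k, A k i * (A k j)⁻¹ = if i = j then (Fintype.card n : ℂ) else 0 :=
  hA.transpose.sum_row i j

theorem isTypeII_of_inv_apply [Nonempty n] {A A' : Matrix n n ℂ} (hA : A * A' = 1)
    (h : ∀ k l, (Fintype.card n : ℂ) * (A' l k * A k l) = 1) : IsTypeII A := by
  have h0 : IsSchurInvertible A := fun k l h0 => by simpa [h0] using h k l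
  refine ⟨h0, ?_⟩
  rw [← hA, ← Matrix.mul_smul]
  congr 1
  ext l k
  have := h k l
  simp only [transpose_apply, schurInv_apply, Matrix.smul_apply, smul_eq_mul]
  exact inv_eq_of_mul_eq_one_left (by rw [← this]; ring)

end TypeII

/-! ### Nomura algebras and their closure properties. -/

section Nomura

variable {n : Type*} [Fintype n]

/-- `μ i j` is an eigenvalue of `M` at the vector `A e_i ∘ B e_j`. -/
def HasEigenmatrix (A B M μ : Matrix n n ℂ) : Prop :=
  ∀ i j x, ∑ k, M x k * (A k i * B k j) = μ i j * (A x i * B x j)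

theorem mem_nomuraPair {A B M : Matrix n n ℂ} :
    M ∈ nomuraPair A B ↔ ∃ μ, HasEigenmatrix A B M μ := by
  constructor
  · intro h
    choose μ hμ using h
    exact ⟨μ, fun i j x => by simpa [mulVec, dotProduct] using congrFun (hμ i j) x⟩
  · rintro ⟨μ, hμ⟩ i j
    exact ⟨μ i j, funext fun x => by simpa [mulVec, dotProduct] using hμ i j x⟩

theorem nomuraPair_comm (A B : Matrix n n ℂ) : nomuraPair A B = nomuraPair B A := by
  have key : ∀ A B : Matrix n n ℂ, nomuraPair A B ≤ nomuraPair B A := by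
    intro A B M hM
    obtain ⟨μ, hμ⟩ := mem_nomuraPair.1 hM
    exact mem_nomuraPair.2 ⟨μᵀ, fun i j x => by
      simpa only [mul_comm (A _ _), transpose_apply] using hμ j i x⟩
  exact le_antisymm (key A B) (key B A)

theorem nomura_schurInv (A : Matrix n n ℂ) : nomura (schurInv A) = nomura A := by
  rw [nomura, nomura, schurInv_schurInv, nomuraPair_comm]

theorem mul_mem_nomuraPair {A B M N : Matrix n n ℂ} (hM : M ∈ nomuraPair A B)
    (hN : N ∈ nomuraPair A B) : M * N ∈ nomuraPair A B := by
  intro i j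
  obtain ⟨μ, hμ⟩ := hM i j
  obtain ⟨ν, hν⟩ := hN i j
  exact ⟨ν * μ, by rw [← Matrix.mulVec_mulVec, hν, Matrix.mulVec_smul, hμ, smul_smul]⟩

theorem inv_mem_nomuraPair [DecidableEq n] {A B M M' : Matrix n n ℂ} (hM : M ∈ nomuraPair A B)
    (h : M' * M = 1) : M' ∈ nomuraPair A B := by
  intro i j
  obtain ⟨μ, hμ⟩ := hM i j
  have h1 := congrArg (M' *ᵥ ·) hμ
  simp only [Matrix.mulVec_mulVec, h, Matrix.one_mulVec, Matrix.mulVec_smul] at h1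
  refine ⟨μ⁻¹, ?_⟩
  -- Since $M$ is injective, the eigenvalue $0$ occurs only when the vector itself is zero; then any
  -- scalar serves.
  by_cases h0 : μ = 0
  · rw [h0, zero_smul] at h1
    rw [h1]; simp
  · conv_rhs => rw [h1]
    rw [smul_smul, inv_mul_cancel₀ h0, one_smul]

theorem one_mem_nomuraPair [DecidableEq n] (A B : Matrix n n ℂ) : 1 ∈ nomuraPair A B :=
  fun i j => ⟨1, by simp⟩

variable [DecidableEq n]

/-- For fixed $i$ the vectors $Ae_i\circ Be_j$ can be inverted in $j$ because $B$ is type II, so $F$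
is recovered from a single row of $\mu$. The Schur product rule, duality and commutativity all rest
on this inversion. -/
theorem HasEigenmatrix.sum_mul {A B F μ : Matrix n n ℂ} (hB : IsTypeII B)
    (h : HasEigenmatrix A B F μ) (i x k : n) :
    (∑ j, μ i j * (B x j * (B k j)⁻¹)) * A x i = Fintype.card n * (F x k * A k i) := by
  calc (∑ j, μ i j * (B x j * (B k j)⁻¹)) * A x i
      = ∑ j, (μ i j * (A x i * B x j)) * (B k j)⁻¹ := by
        rw [Finset.sum_mul]; exact Finset.sum_congr rfl fun j _ => by ring
    _ = ∑ j, ∑ l, F x l * A l i * (B l j * (B k j)⁻¹) := by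
        refine Finset.sum_congr rfl fun j _ => ?_
        rw [← h i j x, Finset.sum_mul]
        exact Finset.sum_congr rfl fun l _ => by ring
    _ = ∑ l, F x l * A l i * ∑ j, B l j * (B k j)⁻¹ := by
        rw [Finset.sum_comm]; simp only [Finset.mul_sum]
    _ = _ := by
        simp only [hB.sum_row, mul_ite, mul_zero, Finset.sum_ite_eq', Finset.mem_univ, if_true]
        ring

/-- Expanding $F$ through row $i$ of $\mu$ produces factors $1/B_{kj}$, which turn the sum over $k$
into the eigenvector equation of $G$. The eigenvalue matrices multiply as matrices, up to the factor
$1/n$. -/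
theorem hadamard_mem_nomuraPair {A B C F G : Matrix n n ℂ} (hB : IsTypeII B)
    (hF : F ∈ nomuraPair A B) (hG : G ∈ nomuraPair (schurInv B) C) :
    F ⊙ G ∈ nomuraPair A C := by
  obtain ⟨μ, hμ⟩ := mem_nomuraPair.1 hF
  obtain ⟨ν, hν⟩ := mem_nomuraPair.1 hG
  refine mem_nomuraPair.2 ⟨(Fintype.card n : ℂ)⁻¹ • (μ * ν), fun i m x => ?_⟩
  have hn : (Fintype.card n : ℂ) ≠ 0 := by
    have : Nonempty n := ⟨x⟩
    exact_mod_cast Fintype.card_ne_zero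
  rw [Matrix.smul_apply, smul_eq_mul, mul_assoc, eq_inv_mul_iff_mul_eq₀ hn]
  calc (Fintype.card n : ℂ) * ∑ k, (F ⊙ G) x k * (A k i * C k m)
      = ∑ k, (Fintype.card n * (F x k * A k i)) * (G x k * C k m) := by
        rw [Finset.mul_sum]
        exact Finset.sum_congr rfl fun k _ => by rw [hadamard_apply]; ring
    _ = ∑ k, ∑ j, (μ i j * B x j * A x i) * (G x k * ((B k j)⁻¹ * C k m)) := by
        refine Finset.sum_congr rfl fun k _ => ?_
        rw [← hμ.sum_mul hB, Finset.sum_mul, Finset.sum_mul]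
        exact Finset.sum_congr rfl fun j _ => by ring
    _ = ∑ j, (μ i j * B x j * A x i) * ∑ k, G x k * ((B k j)⁻¹ * C k m) := by
        rw [Finset.sum_comm]; simp only [Finset.mul_sum]
    _ = ∑ j, (μ i j * ν j m) * (A x i * C x m) := by
        refine Finset.sum_congr rfl fun j _ => ?_
        have := hν j m x
        simp only [schurInv_apply] at this
        rw [this]
        have := hB.1 x j
        field_simp
    _ = _ := by rw [Matrix.mul_apply, Finset.sum_mul]

/-- The eigenvalue matrix of a member of `N_A` lies in `N_{Aᵀ}`, with that member as its
eigenvalue matrix up to transposition and a scalar. -/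
theorem HasEigenmatrix.dual {A F μ : Matrix n n ℂ} (hA : IsTypeII A)
    (h : HasEigenmatrix A (schurInv A) F μ) :
    HasEigenmatrix (schurInv A)ᵀ Aᵀ μ ((Fintype.card n : ℂ) • F) := by
  intro x k i
  have := h.sum_mul hA.schurInv i x k
  simp only [schurInv_apply, inv_inv] at this
  have hx := hA.1 x i
  simp only [transpose_apply, schurInv_apply, Matrix.smul_apply, smul_eq_mul]
  rw [eq_comm, ← mul_right_inj' hx]
  rw [mul_comm (A x i) (∑ j, _), this]
  field_simp

theorem transpose_mem_nomuraPair {A B M : Matrix n n ℂ} (hA : IsTypeII A)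
    (hB : IsSchurInvertible B) (hM : M ∈ nomuraPair A B) :
    Mᵀ ∈ nomuraPair (schurInv A) (schurInv B) := by
  obtain ⟨μ, hμ⟩ := mem_nomuraPair.1 hM
  refine mem_nomuraPair.2 ⟨μ, fun i j x => ?_⟩
  have hn : (Fintype.card n : ℂ) ≠ 0 := by
    have : Nonempty n := ⟨x⟩
    exact_mod_cast Fintype.card_ne_zero
  -- For fixed $j$ the columns of $P$ are the eigenvectors $Ae_i\circ Be_j$, so $MP=PD$ with $D$
  -- diagonal. As $Q=nP^{-1}$, the rows of $Q$ are left eigenvectors of $M$, that is, eigenvectors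
  -- of $M^T$.
  let P : Matrix n n ℂ := diagonal (fun k => B k j) * A
  let Q : Matrix n n ℂ := (schurInv A)ᵀ * diagonal fun k => (B k j)⁻¹
  have hP : ∀ k l, P k l = B k j * A k l := fun k l => diagonal_mul _ _ _ _
  have hQ : ∀ l k, Q l k = (A k l)⁻¹ * (B k j)⁻¹ := fun l k => mul_diagonal _ _ _ _
  have hPQ : P * Q = (Fintype.card n : ℂ) • 1 := by
    have : P * Q = diagonal (fun k => B k j) * (A * (schurInv A)ᵀ) *
      diagonal fun k => (B k j)⁻¹ := by simp only [P, Q, Matrix.mul_assoc]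
    rw [this, hA.2]
    simp only [Matrix.mul_smul, Matrix.smul_mul, Matrix.mul_one, diagonal_mul_diagonal]
    congr 1
    rw [← diagonal_one]
    congr 1
    funext k
    exact mul_inv_cancel₀ (hB k j)
  have hQP : Q * P = (Fintype.card n : ℂ) • 1 := by
    have h1 : P * ((Fintype.card n : ℂ)⁻¹ • Q) = 1 := by
      rw [Matrix.mul_smul, hPQ, smul_smul, inv_mul_cancel₀ hn, one_smul]
    rw [mul_eq_one_comm, Matrix.smul_mul] at h1
    rw [← h1, smul_smul, mul_inv_cancel₀ hn, one_smul]
  have hMP : M * P = P * diagonal fun l => μ l j := by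
    ext y l
    rw [mul_diagonal, Matrix.mul_apply, hP, show B y j * A y l * μ l j =
      μ l j * (A y l * B y j) by ring, ← hμ l j y]
    exact Finset.sum_congr rfl fun k _ => by rw [hP]; ring
  have hQM : Q * M = (diagonal fun l => μ l j) * Q := by
    have h1 : (Q * M) * (P * Q) = (Q * P) * (diagonal fun l => μ l j) * Q := by
      calc (Q * M) * (P * Q) = Q * (M * P) * Q := by simp only [Matrix.mul_assoc]
        _ = _ := by rw [hMP]; simp only [Matrix.mul_assoc]
    rw [hPQ, hQP] at h1
    simp only [Matrix.mul_smul, Matrix.smul_mul, Matrix.mul_one, Matrix.one_mul] at h1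
    exact smul_right_injective _ hn h1
  have := congrFun (congrFun hQM i) x
  rw [diagonal_mul, Matrix.mul_apply, hQ] at this
  simp only [transpose_apply, schurInv_apply]
  rw [← this]
  exact Finset.sum_congr rfl fun k _ => by rw [hQ]; ring

theorem hadamard_mem_nomura {A M N : Matrix n n ℂ} (hA : IsTypeII A) (hM : M ∈ nomura A)
    (hN : N ∈ nomura A) : M ⊙ N ∈ nomura A :=
  hadamard_mem_nomuraPair hA.schurInv hM (by rwa [schurInv_schurInv])

theorem transpose_mem_nomura {A M : Matrix n n ℂ} (hA : IsTypeII A) (hM : M ∈ nomura A) :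
    Mᵀ ∈ nomura A := by
  rw [← nomura_schurInv]
  exact transpose_mem_nomuraPair hA hA.1.schurInv hM

theorem allOnes_mem_nomura {A : Matrix n n ℂ} (hA : IsTypeII A) :
    (Matrix.of fun _ _ => 1) ∈ nomura A := by
  refine mem_nomuraPair.2 ⟨(Fintype.card n : ℂ) • 1, fun i j x => ?_⟩
  simp only [of_apply, one_mul, schurInv_apply, hA.sum_col, Matrix.smul_apply, smul_eq_mul, one_apply]
  split_ifs with h
  · subst h; rw [mul_inv_cancel₀ (hA.1 x i)]; simp
  · simp

theorem mul_comm_of_mem_nomura {A M N : Matrix n n ℂ} (hA : IsTypeII A) (hM : M ∈ nomura A)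
    (hN : N ∈ nomura A) : M * N = N * M := by
  obtain ⟨μ, hμ⟩ := mem_nomuraPair.1 hM
  obtain ⟨ν, hν⟩ := mem_nomuraPair.1 hN
  -- The eigenvalue matrix determines $M$, and it is the same for $MN$ and $NM$.
  have hc : ∀ {M μ : Matrix n n ℂ}, HasEigenmatrix A (schurInv A) M μ → ∀ x k,
      (∑ j, μ k j * ((A k j * (A x j)⁻¹))) * A x k = Fintype.card n * (M x k * A k k) := by
    intro M μ h x k
    rw [← h.sum_mul hA.schurInv]
    simp only [schurInv_apply, inv_inv]
    congr 1
    exact Finset.sum_congr rfl fun j _ => by ring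
  have prod : ∀ {M N μ ν : Matrix n n ℂ}, HasEigenmatrix A (schurInv A) M μ →
      HasEigenmatrix A (schurInv A) N ν →
      HasEigenmatrix A (schurInv A) (M * N) (Matrix.of fun i j => ν i j * μ i j) := by
    intro M N μ ν hM hN i j x
    simp only [Matrix.mul_apply, Finset.sum_mul]
    rw [Finset.sum_comm]
    calc _ = ∑ l, M x l * ∑ k, N l k * (A k i * schurInv A k j) := by
          simp only [Finset.mul_sum, mul_assoc]
      _ = ν i j * ∑ l, M x l * (A l i * schurInv A l j) := by
          simp only [hN i j, Finset.mul_sum]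
          exact Finset.sum_congr rfl fun l _ => by ring
      _ = _ := by rw [hM i j x, of_apply]; ring
  ext x k
  have h1 := hc (prod hμ hν) x k
  have h2 := hc (prod hν hμ) x k
  simp only [of_apply] at h1 h2
  simp only [mul_comm (ν k _)] at h1
  rw [h1] at h2
  have hn : (Fintype.card n : ℂ) ≠ 0 := by
    have : Nonempty n := ⟨x⟩
    exact_mod_cast Fintype.card_ne_zero
  exact mul_right_cancel₀ (hA.1 k k) (mul_left_cancel₀ hn h2)

end Nomura

/-! ### Association schemes from Bose–Mesner algebras, and their restriction. -/

section Scheme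

variable {V : Type*} [Fintype V] [DecidableEq V]

/-- The closure properties that characterize Bose-Mesner algebras. -/
structure IsBoseMesner (𝒩 : Submodule ℂ (Matrix V V ℂ)) : Prop where
  one_mem : 1 ∈ 𝒩
  allOnes_mem : (Matrix.of fun _ _ => 1) ∈ 𝒩
  hadamard_mem : ∀ M ∈ 𝒩, ∀ N ∈ 𝒩, M ⊙ N ∈ 𝒩
  transpose_mem : ∀ M ∈ 𝒩, Mᵀ ∈ 𝒩
  mul_comm : ∀ M ∈ 𝒩, ∀ N ∈ 𝒩, M * N = N * M
  mul_mem : ∀ M ∈ 𝒩, ∀ N ∈ 𝒩, M * N ∈ 𝒩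

theorem isBoseMesner_nomura {A : Matrix V V ℂ} (hA : IsTypeII A) : IsBoseMesner (nomura A) where
  one_mem := one_mem_nomuraPair _ _
  allOnes_mem := allOnes_mem_nomura hA
  hadamard_mem _ hM _ hN := hadamard_mem_nomura hA hM hN
  transpose_mem _ hM := transpose_mem_nomura hA hM
  mul_comm _ hM _ hN := mul_comm_of_mem_nomura hA hM hN
  mul_mem _ hM _ hN := mul_mem_nomuraPair hM hN

/-- A set of non-zero `01`-matrices whose supports partition the pairs of points. -/
structure IsSchurPartition {V : Type*} (𝒜 : Finset (Matrix V V ℂ)) : Prop where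
  zero_one : ∀ M ∈ 𝒜, ∀ x y, M x y = 0 ∨ M x y = 1
  zero_notMem : (0 : Matrix V V ℂ) ∉ 𝒜
  exists_one : ∀ x y, ∃ M ∈ 𝒜, M x y = 1
  eq_of_one : ∀ M ∈ 𝒜, ∀ N ∈ 𝒜, ∀ x y, M x y = 1 → N x y = 1 → M = N

theorem IsSchurPartition.eq_zero {V : Type*} {𝒜 : Finset (Matrix V V ℂ)}
    (h : IsSchurPartition 𝒜) {E F : Matrix V V ℂ} (hE : E ∈ 𝒜) (hF : F ∈ 𝒜) {x y : V}
    (h1 : E x y = 1) (hne : F ≠ E) : F x y = 0 :=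
  (h.zero_one F hF x y).resolve_right fun h2 => hne (h.eq_of_one F hF E hE x y h2 h1)

theorem IsSchurPartition.apply_eq {V : Type*} {𝒜 : Finset (Matrix V V ℂ)}
    (h : IsSchurPartition 𝒜) {E M : Matrix V V ℂ} (hE : E ∈ 𝒜)
    (hM : M ∈ Submodule.span ℂ (𝒜 : Set (Matrix V V ℂ))) {x y x' y' : V}
    (h1 : E x y = 1) (h2 : E x' y' = 1) : M x y = M x' y' := by
  induction hM using Submodule.span_induction with
  | mem F hF =>
    by_cases hFE : F = E
    · rw [hFE, h1, h2]
    · rw [h.eq_zero hE hF h1 hFE, h.eq_zero hE hF h2 hFE]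
  | zero => rfl
  | add M N _ _ hM hN => simp [hM, hN]
  | smul c M _ hM => simp [hM]

theorem IsSchurPartition.sum_eq {V : Type*} {𝒜 : Finset (Matrix V V ℂ)}
    (h : IsSchurPartition 𝒜) : ∑ M ∈ 𝒜, M = Matrix.of fun _ _ => 1 := by
  ext x y
  obtain ⟨E, hE, h1⟩ := h.exists_one x y
  rw [Matrix.sum_apply, Finset.sum_eq_single_of_mem E hE fun F hF hne => h.eq_zero hE hF h1 hne,
    h1, of_apply]

theorem IsAssociationScheme.isSchurPartition {𝒜 : Finset (Matrix V V ℂ)}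
    (h : IsAssociationScheme 𝒜) : IsSchurPartition 𝒜 := by
  classical
  have hs : ∀ x y, ((𝒜.filter fun M => M x y = 1).card : ℂ) = 1 := by
    intro x y
    have h1 := congrFun (congrFun h.sum_eq x) y
    rw [Matrix.sum_apply, of_apply] at h1
    refine Eq.trans ?_ h1
    rw [Finset.card_filter, Nat.cast_sum]
    refine Finset.sum_congr rfl fun M hM => ?_
    rcases h.zero_one M hM x y with h0 | h0 <;> simp [h0]
  refine ⟨h.zero_one, h.zero_notMem, fun x y => ?_, fun M hM N hN x y hMx hNx => ?_⟩
  · have h1 : (𝒜.filter fun M => M x y = 1).card = 1 := by exact_mod_cast hs x y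
    obtain ⟨E, hE⟩ := Finset.card_pos.1 (h1 ▸ Nat.one_pos)
    exact ⟨E, (Finset.mem_filter.1 hE).1, (Finset.mem_filter.1 hE).2⟩
  · have h1 : (𝒜.filter fun M => M x y = 1).card = 1 := by exact_mod_cast hs x y
    exact Finset.card_le_one.1 h1.le M (Finset.mem_filter.2 ⟨hM, hMx⟩) N
      (Finset.mem_filter.2 ⟨hN, hNx⟩)

theorem IsSchurPartition.eq_of_support_le {V : Type*} {𝒜 : Finset (Matrix V V ℂ)}
    (h : IsSchurPartition 𝒜) {E M : Matrix V V ℂ} (hE : E ∈ 𝒜)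
    (hM01 : ∀ x y, M x y = 0 ∨ M x y = 1)
    (h1 : ∀ x y, E x y = 1 ↔ M x y = 1) : E = M := by
  ext x y
  rcases h.zero_one E hE x y with h0 | h0
  · rcases hM01 x y with h2 | h2
    · rw [h0, h2]
    · rw [(h1 x y).2 h2, h2]
  · rw [h0, (h1 x y).1 h0]

theorem IsSchurPartition.isSchemeOf [Nonempty V] {𝒜 : Finset (Matrix V V ℂ)}
    (h : IsSchurPartition 𝒜) {𝒩 : Submodule ℂ (Matrix V V ℂ)} (h𝒩 : IsBoseMesner 𝒩)
    (hspan : Submodule.span ℂ (𝒜 : Set (Matrix V V ℂ)) = 𝒩) : IsSchemeOf 𝒜 𝒩 := by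
  have hmem : ∀ M ∈ 𝒜, M ∈ 𝒩 := fun M hM => hspan ▸ Submodule.subset_span hM
  refine ⟨⟨h.zero_one, h.zero_notMem, ?_, h.sum_eq, ?_, ?_, ?_⟩, hspan⟩
  · obtain ⟨v⟩ := ‹Nonempty V›
    obtain ⟨E, hE, hv⟩ := h.exists_one v v
    -- $I$ is constant on the class of $(v,v)$, so this class lies in the diagonal; commuting with
    -- $J$ equates its row and column sums, so it is the whole diagonal.
    have hoff : ∀ x y, E x y = 1 → x = y := by
      intro x y hxy
      have := h.apply_eq hE (hspan ▸ h𝒩.one_mem) hxy hv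
      by_contra hne
      simp [hne] at this
    have hoff' : ∀ x y, x ≠ y → E x y = 0 := fun x y hne =>
      (h.zero_one E hE x y).resolve_right fun h1 => hne (hoff x y h1)
    have hdiag : ∀ x, E x x = 1 := by
      intro x
      have := congrFun (congrFun (h𝒩.mul_comm E (hmem E hE) _ h𝒩.allOnes_mem) x) v
      simp only [Matrix.mul_apply, of_apply, mul_one, one_mul] at this
      rw [Finset.sum_eq_single x (fun y _ hy => hoff' x y hy.symm) (by simp),
        Finset.sum_eq_single v (fun y _ hy => hoff' y v hy) (by simp)] at this
      rw [this, hv]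
    have : E = 1 := by
      ext x y
      by_cases hxy : x = y
      · subst hxy; rw [hdiag, one_apply_eq]
      · rw [hoff' x y hxy, one_apply_ne hxy]
    exact this ▸ hE
  · have hspanT : ∀ E ∈ 𝒜, Eᵀ ∈ Submodule.span ℂ (𝒜 : Set (Matrix V V ℂ)) := fun E hE =>
      hspan ▸ h𝒩.transpose_mem E (hmem E hE)
    intro E hE
    have hne : ∃ x y, E x y = 1 := by
      by_contra! hcon
      exact h.zero_notMem (by
        have : E = 0 := by
          ext x y
          exact (h.zero_one E hE x y).resolve_right (hcon x y)
        rwa [this] at hE)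
    obtain ⟨x, y, hxy⟩ := hne
    obtain ⟨F, hF, hyx⟩ := h.exists_one y x
    have : F = Eᵀ := by
      refine h.eq_of_support_le hF (fun a b => h.zero_one E hE b a) fun a b => ⟨fun hab => ?_,
        fun hab => ?_⟩
      · exact (h.apply_eq hF (hspanT E hE) hab hyx).trans hxy
      · exact (h.apply_eq hE (hspanT F hF) hab hxy).trans hyx
    exact this ▸ hF
  · exact fun M hM N hN => h𝒩.mul_comm M (hmem M hM) N (hmem N hN)
  · exact fun M hM N hN => hspan ▸ h𝒩.mul_mem M (hmem M hM) N (hmem N hN)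

-- The classes are the sets of index pairs that no member of $\mathcal N$ separates. The indicator
-- of a class is a Schur product of members of $\mathcal N$, each equal to $1$ on the class and
-- vanishing at one pair outside it.
omit [DecidableEq V] in
theorem exists_isSchurPartition {𝒩 : Submodule ℂ (Matrix V V ℂ)}
    (hJ : (Matrix.of fun _ _ => 1) ∈ 𝒩) (hS : ∀ M ∈ 𝒩, ∀ N ∈ 𝒩, M ⊙ N ∈ 𝒩) :
    ∃ 𝒜 : Finset (Matrix V V ℂ), IsSchurPartition 𝒜 ∧
      Submodule.span ℂ (𝒜 : Set (Matrix V V ℂ)) = 𝒩 := by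
  classical
  let r : V × V → V × V → Prop := fun p q => ∀ M ∈ 𝒩, M p.1 p.2 = M q.1 q.2
  let e : V × V → Matrix V V ℂ := fun p => Matrix.of fun x y => if r p (x, y) then 1 else 0
  have e_one : ∀ p x y, e p x y = 1 ↔ r p (x, y) := by
    intro p x y; simp [e]
  have hsep : ∀ p q, ∃ F ∈ 𝒩, F p.1 p.2 = 1 ∧ (¬ r p q → F q.1 q.2 = 0) := by
    intro p q
    by_cases hpq : r p q
    · exact ⟨_, hJ, rfl, fun h => absurd hpq h⟩
    · have hpq' := hpq
      simp only [r] at hpq'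
      push Not at hpq'
      obtain ⟨M, hM, hne⟩ := hpq'
      refine ⟨(M p.1 p.2 - M q.1 q.2)⁻¹ • (M - M q.1 q.2 • Matrix.of fun _ _ => 1),
        𝒩.smul_mem _ (𝒩.sub_mem hM (𝒩.smul_mem _ hJ)), ?_, fun _ => ?_⟩
      · simp [inv_mul_cancel₀ (sub_ne_zero.2 hne)]
      · simp
  choose F hF hF1 hF0 using hsep
  have hprod : ∀ (p : V × V) (s : Finset (V × V)),
      (Matrix.of fun x y => ∏ q ∈ s, F p q x y) ∈ 𝒩 := by
    intro p s
    induction s using Finset.induction_on with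
    | empty => simpa using hJ
    | insert q s hq ih =>
      have : (Matrix.of fun x y => ∏ q ∈ insert q s, F p q x y) =
          F p q ⊙ Matrix.of fun x y => ∏ q ∈ s, F p q x y := by
        ext x y; simp [Finset.prod_insert hq]
      rw [this]
      exact hS _ (hF p q) _ ih
  have he : ∀ p, e p ∈ 𝒩 := by
    intro p
    have : e p = Matrix.of fun x y => ∏ q ∈ Finset.univ, F p q x y := by
      ext x y
      simp only [e, of_apply]
      split_ifs with h
      · exact (Finset.prod_eq_one fun q _ => by rw [← h _ (hF p q), hF1]).symm
      · exact (Finset.prod_eq_zero (Finset.mem_univ (x, y)) (hF0 p (x, y) h)).symm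
    rw [this]
    exact hprod p _
  have e_congr : ∀ p q, r p q → e p = e q := by
    intro p q hpq
    ext x y
    have : r p (x, y) ↔ r q (x, y) :=
      ⟨fun h M hM => (hpq M hM).symm.trans (h M hM), fun h M hM => (hpq M hM).trans (h M hM)⟩
    simp only [e, of_apply, this]
  have r_refl : ∀ p, r p p := fun p M _ => rfl
  have hpart : IsSchurPartition (Finset.univ.image e) := by
    refine ⟨?_, ?_, ?_, ?_⟩
    · intro M hM x y
      obtain ⟨p, -, rfl⟩ := Finset.mem_image.1 hM
      simp only [e, of_apply]
      split_ifs <;> simp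
    · intro h0
      obtain ⟨p, -, hp⟩ := Finset.mem_image.1 h0
      have := (e_one p p.1 p.2).2 (r_refl p)
      rw [hp] at this
      simp at this
    · exact fun x y => ⟨e (x, y), Finset.mem_image_of_mem _ (Finset.mem_univ _),
        (e_one _ _ _).2 (r_refl _)⟩
    · intro M hM N hN x y hMx hNx
      obtain ⟨p, -, rfl⟩ := Finset.mem_image.1 hM
      obtain ⟨q, -, rfl⟩ := Finset.mem_image.1 hN
      rw [e_congr p _ ((e_one _ _ _).1 hMx), e_congr q _ ((e_one _ _ _).1 hNx)]
  refine ⟨Finset.univ.image e, hpart, le_antisymm (Submodule.span_le.2 ?_) fun M hM => ?_⟩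
  · intro E hE
    obtain ⟨p, -, rfl⟩ := Finset.mem_image.1 (Finset.mem_coe.1 hE)
    exact he p
  -- The coefficients must depend on the class, not on a representing pair, because the sum runs
  -- over the image of `e`; the value $0$ off the image is never used.
  · have hval : ∀ E : Matrix V V ℂ, ∃ m : ℂ, ∀ p, E = e p → m = M p.1 p.2 := by
      intro E
      by_cases h : ∃ p, E = e p
      · obtain ⟨p, rfl⟩ := h
        refine ⟨M p.1 p.2, fun q hq => ?_⟩
        have : r p q := (e_one p q.1 q.2).1 (by rw [hq]; exact (e_one _ _ _).2 (r_refl q))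
        exact this M hM
      · exact ⟨0, fun p hp => absurd ⟨p, hp⟩ h⟩
    choose m hm using hval
    have : M = ∑ E ∈ Finset.univ.image e, m E • E := by
      ext x y
      have hE : e (x, y) ∈ Finset.univ.image e := Finset.mem_image_of_mem _ (Finset.mem_univ _)
      have h1 : e (x, y) x y = 1 := (e_one _ _ _).2 (r_refl _)
      rw [Matrix.sum_apply, Finset.sum_eq_single_of_mem _ hE fun F hF hne => by
        rw [Matrix.smul_apply, hpart.eq_zero hE hF h1 hne, smul_zero]]
      rw [Matrix.smul_apply, h1, hm _ (x, y) rfl, smul_eq_mul, mul_one]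
    rw [this]
    exact Submodule.sum_mem _ fun E hE => Submodule.smul_mem _ _ (Submodule.subset_span hE)

theorem IsBoseMesner.exists_isSchemeOf [Nonempty V] {𝒩 : Submodule ℂ (Matrix V V ℂ)}
    (h : IsBoseMesner 𝒩) : ∃ 𝒜, IsSchemeOf 𝒜 𝒩 := by
  obtain ⟨𝒜, h𝒜, hspan⟩ := exists_isSchurPartition h.allOnes_mem h.hadamard_mem
  exact ⟨𝒜, h𝒜.isSchemeOf h hspan⟩

theorem mem_restrictScheme {V Y : Type*} {f : Y ↪ V} {𝒜 : Finset (Matrix V V ℂ)}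
    {N : Matrix Y Y ℂ} : N ∈ restrictScheme f 𝒜 ↔ (∃ M ∈ 𝒜, M.submatrix f f = N) ∧ N ≠ 0 := by
  classical
  simp [restrictScheme]

theorem IsSchurPartition.restrictScheme {V Y : Type*} {𝒜 : Finset (Matrix V V ℂ)}
    (h : IsSchurPartition 𝒜) (f : Y ↪ V) : IsSchurPartition (restrictScheme f 𝒜) := by
  refine ⟨?_, ?_, ?_, ?_⟩
  · intro M hM x y
    obtain ⟨⟨M, hM', rfl⟩, -⟩ := mem_restrictScheme.1 hM
    exact h.zero_one M hM' _ _
  · exact fun h0 => (mem_restrictScheme.1 h0).2 rfl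
  · intro x y
    obtain ⟨M, hM, h1⟩ := h.exists_one (f x) (f y)
    refine ⟨M.submatrix f f, mem_restrictScheme.2 ⟨⟨M, hM, rfl⟩, fun h0 => ?_⟩, h1⟩
    have := congrFun (congrFun h0 x) y
    simp [h1] at this
  · intro M hM N hN x y hMx hNx
    obtain ⟨⟨M, hM', rfl⟩, -⟩ := mem_restrictScheme.1 hM
    obtain ⟨⟨N, hN', rfl⟩, -⟩ := mem_restrictScheme.1 hN
    rw [h.eq_of_one M hM' N hN' _ _ hMx hNx]

/-- Restriction of matrices to the rows and columns in the range of `f`, as a linear map. -/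
def restrictLinear {V Y : Type*} (f : Y ↪ V) : Matrix V V ℂ →ₗ[ℂ] Matrix Y Y ℂ where
  toFun M := M.submatrix f f
  map_add' _ _ := rfl
  map_smul' _ _ := rfl

theorem span_restrictScheme {V Y : Type*} (f : Y ↪ V) (𝒜 : Finset (Matrix V V ℂ)) :
    Submodule.span ℂ (restrictScheme f 𝒜 : Set (Matrix Y Y ℂ)) =
      (Submodule.span ℂ (𝒜 : Set (Matrix V V ℂ))).map (restrictLinear f) := by
  rw [Submodule.map_span]
  refine le_antisymm (Submodule.span_mono ?_) (Submodule.span_le.2 ?_)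
  · intro N hN
    obtain ⟨⟨M, hM, rfl⟩, -⟩ := mem_restrictScheme.1 (Finset.mem_coe.1 hN)
    exact ⟨M, hM, rfl⟩
  · rintro N ⟨M, hM, rfl⟩
    by_cases h0 : restrictLinear f M = 0
    · rw [h0]; exact Submodule.zero_mem _
    · exact Submodule.subset_span (mem_restrictScheme.2 ⟨⟨M, hM, rfl⟩, h0⟩)

theorem IsSchemeOf.restrictScheme {Y : Type*} [Fintype Y] [DecidableEq Y] [Nonempty Y]
    {𝒜 : Finset (Matrix V V ℂ)} {𝒩 : Submodule ℂ (Matrix V V ℂ)} (h : IsSchemeOf 𝒜 𝒩)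
    (f : Y ↪ V) (h𝒩 : IsBoseMesner (𝒩.map (restrictLinear f))) :
    IsSchemeOf (restrictScheme f 𝒜) (𝒩.map (restrictLinear f)) :=
  (h.1.isSchurPartition.restrictScheme f).isSchemeOf h𝒩 (by rw [span_restrictScheme, h.2])

end Scheme

/-! ### Jones pairs: the type II property and the symmetrizer $C$. -/

section JonesPair

variable {n : Type*} [Fintype n] [DecidableEq n]

theorem IsOneSidedJonesPair.hasEigenmatrix {A B : Matrix n n ℂ} (h : IsOneSidedJonesPair A B) :
    HasEigenmatrix A B A B := by
  intro i j x
  -- The test matrix has every column equal to $e_i$; column $j$ of the relation is the eigenvector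
  -- equation.
  have h1 := congrFun (congrFun (congrFun h (Matrix.of fun k _ => if k = i then 1 else 0)) x) j
  simp only [Function.comp_apply, X, Delta, Matrix.mul_apply, hadamard_apply, of_apply, mul_ite,
    mul_one, mul_zero, Finset.sum_ite_eq', Finset.mem_univ, if_true] at h1
  rw [show B i j * (A x i * B x j) = B x j * (A x i * B i j) by ring, ← h1]
  exact Finset.sum_congr rfl fun k _ => by ring

-- In $\sum_k A_{xk}A_{ki}B_{kj}=A_{xi}B_{ij}B_{xj}$, transposing $A$ only swaps $x$ and $i$.
omit [DecidableEq n] in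
theorem HasEigenmatrix.transpose_left {A B : Matrix n n ℂ} (h : HasEigenmatrix A B A B) :
    HasEigenmatrix Aᵀ B Aᵀ B := by
  intro i j x
  have h1 := h x j i
  simp only [transpose_apply]
  rw [show B i j * (A i x * B x j) = B x j * (A i x * B i j) by ring, ← h1]
  exact Finset.sum_congr rfl fun k _ => by ring

/-- A doubly stochastic array whose rows are all mapped to constant vectors by an invertible
matrix has constant entries. -/
theorem card_mul_eq_one_of_sum_mul_eq {B : Matrix n n ℂ} (hB : IsUnit B) {w : n → n → ℂ}
    {a : n → ℂ} (hrow : ∀ l, ∑ k, w l k = 1) (hcol : ∀ k, ∑ l, w l k = 1)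
    (h : ∀ l j, ∑ k, w l k * B k j = a l) (l k : n) : (Fintype.card n : ℂ) * w l k = 1 := by
  have hBB : B * B⁻¹ = 1 := Matrix.mul_nonsing_inv _ ((Matrix.isUnit_iff_isUnit_det _).1 hB)
  -- Inverting $B$ shows that $w$ has rank one; the row sums make its rows equal, and then the
  -- column sums fix the entries.
  have hw : ∀ l k, w l k = a l * ∑ j, B⁻¹ j k := by
    intro l k
    have h1 : w l ᵥ* B = fun _ => a l := funext fun j => by simpa [vecMul, dotProduct] using h l j
    have h2 := congrArg (· ᵥ* B⁻¹) h1
    simp only [vecMul_vecMul, hBB, vecMul_one] at h2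
    rw [h2]
    simp [vecMul, dotProduct, Finset.mul_sum]
  have ha : ∀ l, a l * ∑ k, ∑ j, B⁻¹ j k = 1 := by
    intro l
    rw [Finset.mul_sum, ← hrow l]
    exact Finset.sum_congr rfl fun k _ => (hw l k).symm
  have hconst : ∀ m, w m k = w l k := by
    intro m
    have : a m = a l := mul_right_cancel₀ (right_ne_zero_of_mul_eq_one (ha l))
      ((ha m).trans (ha l).symm)
    rw [hw, hw, this]
  rw [← hcol k, Finset.sum_congr rfl fun m _ => hconst m, Finset.sum_const, Finset.card_univ,
    nsmul_eq_mul]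

theorem HasEigenmatrix.isTypeII_left [Nonempty n] {A B : Matrix n n ℂ}
    (h : HasEigenmatrix A B A B) (hA : IsUnit A) (hB : IsUnit B) (hB0 : IsSchurInvertible B) :
    IsTypeII A := by
  have hAA : A * A⁻¹ = 1 := Matrix.mul_nonsing_inv _ ((Matrix.isUnit_iff_isUnit_det _).1 hA)
  have hAA' : A⁻¹ * A = 1 := Matrix.nonsing_inv_mul _ ((Matrix.isUnit_iff_isUnit_det _).1 hA)
  refine isTypeII_of_inv_apply hAA fun k l => ?_
  refine card_mul_eq_one_of_sum_mul_eq (w := fun l k => A⁻¹ l k * A k l) (a := fun l => A l l)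
    hB (fun l => ?_) (fun k => ?_) (fun l j => ?_) l k
  · simpa [Matrix.mul_apply] using congrFun (congrFun hAA' l) l
  · simpa [Matrix.mul_apply, mul_comm] using congrFun (congrFun hAA k) k
  · refine mul_left_cancel₀ (hB0 l j) ?_
    calc B l j * ∑ k, A⁻¹ l k * A k l * B k j
        = ∑ k, A⁻¹ l k * (B l j * (A k l * B k j)) := by
          rw [Finset.mul_sum]; exact Finset.sum_congr rfl fun k _ => by ring
      _ = ∑ k, ∑ m, A⁻¹ l k * A k m * (A m l * B m j) := by
          refine Finset.sum_congr rfl fun k _ => ?_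
          rw [← h l j k, Finset.mul_sum]
          exact Finset.sum_congr rfl fun m _ => by ring
      _ = ∑ m, (A⁻¹ * A) l m * (A m l * B m j) := by
          rw [Finset.sum_comm]; simp only [Matrix.mul_apply, Finset.sum_mul]
      _ = B l j * A l l := by simp [hAA', Matrix.one_apply, mul_comm]

/-- The sum on the right is symmetric in $i,l$ and does not involve $A$, hence it is unchanged when
$A$ is replaced by $A^T$. The case $m=i$ yields that $B$ is type II. -/
theorem HasEigenmatrix.mul_apply_eq {A B : Matrix n n ℂ} (h : HasEigenmatrix A B A B)
    (hB : IsUnit B) (i l m : n) :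
    A i m * A m l = A i l * ∑ j, B i j * B l j * B⁻¹ j m := by
  have hBB : B * B⁻¹ = 1 := Matrix.mul_nonsing_inv _ ((Matrix.isUnit_iff_isUnit_det _).1 hB)
  symm
  calc A i l * ∑ j, B i j * B l j * B⁻¹ j m
      = ∑ j, (B l j * (A i l * B i j)) * B⁻¹ j m := by
        rw [Finset.mul_sum]; exact Finset.sum_congr rfl fun k _ => by ring
    _ = ∑ j, ∑ k, A i k * A k l * (B k j * B⁻¹ j m) := by
        refine Finset.sum_congr rfl fun j _ => ?_
        rw [← h l j i, Finset.sum_mul]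
        exact Finset.sum_congr rfl fun k _ => by ring
    _ = ∑ k, A i k * A k l * (B * B⁻¹) k m := by
        rw [Finset.sum_comm]; simp only [Matrix.mul_apply, Finset.mul_sum]
    _ = A i m * A m l := by simp [hBB, Matrix.one_apply]

theorem HasEigenmatrix.isTypeII_right [Nonempty n] {A B : Matrix n n ℂ}
    (h : HasEigenmatrix A B A B) (hA : IsSchurInvertible A) (hB : IsUnit B) : IsTypeII B := by
  have hBB : B * B⁻¹ = 1 := Matrix.mul_nonsing_inv _ ((Matrix.isUnit_iff_isUnit_det _).1 hB)
  have hBB' : B⁻¹ * B = 1 := Matrix.nonsing_inv_mul _ ((Matrix.isUnit_iff_isUnit_det _).1 hB)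
  refine isTypeII_of_inv_apply hBB fun i k => ?_
  refine card_mul_eq_one_of_sum_mul_eq (B := Bᵀ) (w := fun i k => B⁻¹ k i * B i k)
    (a := fun i => A i i) ((Matrix.isUnit_transpose _).2 hB) (fun i => ?_) (fun k => ?_)
    (fun i l => ?_) i k
  · simpa [Matrix.mul_apply, mul_comm] using congrFun (congrFun hBB i) i
  · simpa [Matrix.mul_apply] using congrFun (congrFun hBB' k) k
  · refine mul_left_cancel₀ (hA i l) ?_
    rw [mul_comm _ (A i i), h.mul_apply_eq hB i l i]
    congr 1
    exact Finset.sum_congr rfl fun k _ => by rw [transpose_apply]; ring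

theorem isSymmetrizer_iff {A : Matrix n n ℂ} {c : n → ℂ} :
    IsSymmetrizer A c ↔ (∀ i, c i ≠ 0) ∧ ∀ i m, A m i = (c i ^ 2)⁻¹ * A i m * c m ^ 2 := by
  unfold IsSymmetrizer
  refine and_congr_right fun hc => ?_
  have hinv : (diagonal c ^ 2)⁻¹ = diagonal fun i => (c i ^ 2)⁻¹ := by
    refine Matrix.inv_eq_left_inv ?_
    rw [diagonal_pow, diagonal_mul_diagonal, ← diagonal_one]
    congr 1
    funext i
    exact inv_mul_cancel₀ (pow_ne_zero 2 (hc i))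
  rw [hinv, diagonal_pow, ← Matrix.ext_iff]
  simp [mul_diagonal, diagonal_mul]

theorem HasEigenmatrix.exists_isSymmetrizer [Nonempty n] {A B : Matrix n n ℂ}
    (h : HasEigenmatrix A B A B) (hA : IsSchurInvertible A) (hB : IsUnit B) :
    ∃ c, IsSymmetrizer A c := by
  obtain ⟨l⟩ := ‹Nonempty n›
  have hsq : ∀ i, ∃ z : ℂ, z ^ 2 = A i l / A l i := fun i =>
    IsAlgClosed.exists_pow_nat_eq _ two_pos
  -- With $l$ fixed, $c_i^2=A_{il}/A_{li}$. Comparing `HasEigenmatrix.mul_apply_eq` for $A$ and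
  -- $A^T$ gives $A_{im}/A_{mi}=c_i^2/c_m^2$.
  choose c hc using hsq
  refine ⟨c, isSymmetrizer_iff.2 ⟨fun i h0 => ?_, fun i m => ?_⟩⟩
  · have := hc i
    rw [h0, zero_pow two_ne_zero] at this
    exact div_ne_zero (hA i l) (hA l i) this.symm
  · rw [hc, hc]
    have h1 := h.mul_apply_eq hB i l m
    have h2 := h.transpose_left.mul_apply_eq hB i l m
    simp only [transpose_apply] at h2
    have h3 : A i m * A m l * A l i = A m i * A l m * A i l := by rw [h1, h2]; ring
    have := hA i l
    have := hA l i
    have := hA l m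
    field_simp
    linear_combination -h3

/-! ### Comparison of the Nomura algebras of $A$, $A^T$ and $B$. -/

omit [DecidableEq n] in
theorem HasEigenmatrix.scale {A A' M μ : Matrix n n ℂ} {s t : n → ℂ}
    (hs : ∀ x, s x ≠ 0) (hA' : ∀ x i, A' x i = s x * A x i * t i)
    (h : HasEigenmatrix A (schurInv A) M μ) : HasEigenmatrix A' (schurInv A') M μ := by
  have key : ∀ x i j, A' x i * schurInv A' x j = t i * (t j)⁻¹ * (A x i * schurInv A x j) := by
    intro x i j
    simp only [schurInv_apply, hA', mul_inv]
    rw [show s x * A x i * t i * ((s x)⁻¹ * (A x j)⁻¹ * (t j)⁻¹) =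
      (s x * (s x)⁻¹) * (t i * (t j)⁻¹ * (A x i * (A x j)⁻¹)) by ring,
      mul_inv_cancel₀ (hs x), one_mul]
  intro i j x
  simp only [key]
  rw [mul_left_comm, ← h i j x, Finset.mul_sum]
  exact Finset.sum_congr rfl fun k _ => by ring

theorem nomura_transpose {A : Matrix n n ℂ} {c : n → ℂ} (hc : IsSymmetrizer A c) :
    nomura Aᵀ = nomura A := by
  obtain ⟨hc0, hc⟩ := isSymmetrizer_iff.1 hc
  have hsq : ∀ i, c i ^ 2 ≠ 0 := fun i => pow_ne_zero 2 (hc0 i)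
  apply le_antisymm
  · intro M hM
    obtain ⟨μ, hμ⟩ := mem_nomuraPair.1 hM
    refine mem_nomuraPair.2 ⟨μ, hμ.scale (s := fun i => c i ^ 2) (t := fun i => (c i ^ 2)⁻¹)
      hsq fun x i => ?_⟩
    have := hc0 x
    have := hc0 i
    rw [transpose_apply, hc x i]
    field_simp
  · intro M hM
    obtain ⟨μ, hμ⟩ := mem_nomuraPair.1 hM
    exact mem_nomuraPair.2 ⟨μ, hμ.scale (s := fun i => (c i ^ 2)⁻¹) (t := fun i => c i ^ 2)
      (fun i => inv_ne_zero (hsq i)) fun x i => hc x i⟩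

/-- For $F\in\mathcal N_A$ write $F=(A\circ F)\circ A^{(-)}$. The exchange rule puts $A\circ F$ into
$\mathcal N_{B,A}$. Since $A^{-1}=\frac1n(A^{(-)})^T$ lies in $\mathcal N_{A,B}$, its transpose
gives $A^{(-)}\in\mathcal N_{A^{(-)},B^{(-)}}$, and a second exchange lands in $\mathcal N_B$. -/
theorem HasEigenmatrix.nomura_le {A B : Matrix n n ℂ} (h : HasEigenmatrix A B A B)
    (hA : IsTypeII A) (hB : IsSchurInvertible B) : nomura A ≤ nomura B := by
  intro F hF
  have hAB : A ∈ nomuraPair A B := mem_nomuraPair.2 ⟨B, h⟩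
  have hinv : schurInv A ∈ nomuraPair (schurInv A) (schurInv B) := by
    rcases isEmpty_or_nonempty n with hn | hn
    · exact fun i => isEmptyElim i
    have hn : (Fintype.card n : ℂ) ≠ 0 := by exact_mod_cast Fintype.card_ne_zero
    have h1 : (Fintype.card n : ℂ)⁻¹ • (schurInv A)ᵀ ∈ nomuraPair A B := by
      refine inv_mem_nomuraPair hAB ?_
      rw [Matrix.smul_mul, hA.transpose_schurInv_mul, smul_smul, inv_mul_cancel₀ hn, one_smul]
    have h2 := Submodule.smul_mem _ (Fintype.card n : ℂ) h1
    rw [smul_smul, mul_inv_cancel₀ hn, one_smul] at h2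
    exact transpose_mem_nomuraPair hA hB h2
  have h1 : A ⊙ F ∈ nomuraPair B A :=
    hadamard_mem_nomuraPair hA (nomuraPair_comm A B ▸ hAB) (nomuraPair_comm A _ ▸ hF)
  have h2 : (A ⊙ F) ⊙ schurInv A ∈ nomuraPair B (schurInv B) :=
    hadamard_mem_nomuraPair hA h1 hinv
  have h3 : (A ⊙ F) ⊙ schurInv A = F := by
    ext i j
    have := hA.1 i j
    simp only [hadamard_apply, schurInv_apply]
    field_simp
  rwa [h3] at h2

/-- A member of `N_{Aᵀ}` has the same eigenvalue matrix as some member of `N_{(B⁽⁻⁾)ᵀ}`. -/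
theorem exists_hasEigenmatrix_of_nomura_le {A B P μ : Matrix n n ℂ} (hA : IsTypeII A)
    (hB : IsTypeII B) (hle : nomura A ≤ nomura B)
    (hP : HasEigenmatrix Aᵀ (schurInv Aᵀ) P μ) :
    ∃ S, HasEigenmatrix (schurInv B)ᵀ (schurInv (schurInv B)ᵀ) S μ := by
  have h1 : μ ∈ nomura A := by
    rw [nomura, nomuraPair_comm]
    exact mem_nomuraPair.2 ⟨_, hP.dual hA.transpose⟩
  obtain ⟨ν, hν⟩ := mem_nomuraPair.1 (hle h1)
  -- Duality applied twice, for $A^T$ and then for $B$, returns $\mu$ multiplied by $n$; the scalar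
  -- in the witness removes this factor.
  refine ⟨(Fintype.card n : ℂ)⁻¹ • ν, fun i j x => ?_⟩
  have hn : (Fintype.card n : ℂ) ≠ 0 := by
    have : Nonempty n := ⟨x⟩
    exact_mod_cast Fintype.card_ne_zero
  have h2 := hν.dual hB i j x
  rw [← schurInv_transpose, schurInv_schurInv, schurInv_transpose]
  simp only [Matrix.smul_apply, smul_eq_mul, mul_assoc] at h2 ⊢
  rw [← Finset.mul_sum, h2, inv_mul_cancel_left₀ hn]

/-! ### The Nomura algebra of $W$ and its upper left block. -/

theorem isTypeII_matrixW {A B : Matrix n n ℂ} {c : n → ℂ} (hA : IsTypeII A) (hB : IsTypeII B)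
    (hc : ∀ i, c i ≠ 0) : IsTypeII (matrixW A B c) := by
  have hrowA := hA.sum_col
  have hrowB : ∀ i j, ∑ k, ((schurInv B)ᵀ * diagonal c) i k *
      (((schurInv B)ᵀ * diagonal c) j k)⁻¹ = if i = j then (Fintype.card n : ℂ) else 0 := by
    intro i j
    rw [← hB.schurInv.sum_col i j]
    refine Finset.sum_congr rfl fun k _ => ?_
    simp only [mul_diagonal, transpose_apply, schurInv_apply]
    have := hc k
    field_simp
  constructor
  · rintro (i | i) (j | j)
    · exact hA.1 j i
    · exact neg_ne_zero.2 (hA.1 j i)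
    all_goals
      simp only [matrixW, fromBlocks_apply₂₁, fromBlocks_apply₂₂, mul_diagonal, transpose_apply,
        schurInv_apply]
      exact mul_ne_zero (inv_ne_zero (hB.1 _ _)) (hc _)
  · ext (i | i) (j | j) <;>
    rw [Matrix.mul_apply] <;>
    simp only [matrixW, transpose_apply, Fintype.sum_sum_type, schurInv_apply,
      fromBlocks_apply₁₁, fromBlocks_apply₁₂, fromBlocks_apply₂₁, fromBlocks_apply₂₂,
      Matrix.neg_apply, inv_neg, mul_neg, neg_mul, neg_neg,
      Finset.sum_neg_distrib, hrowA, hrowB, Matrix.smul_apply, smul_eq_mul, Matrix.one_apply,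
      Sum.inl.injEq, Sum.inr.injEq, Fintype.card_sum, Nat.cast_add, reduceCtorEq, if_false,
      add_neg_cancel, mul_zero] <;>
    split_ifs <;> ring

theorem map_restrictLinear_nomura_matrixW {A B : Matrix n n ℂ} {c : n → ℂ} (hA : IsTypeII A)
    (hB : IsTypeII B) (hle : nomura A ≤ nomura B) :
    (nomura (matrixW A B c)).map (restrictLinear Function.Embedding.inl) = nomura Aᵀ := by
  apply le_antisymm
  · rintro _ ⟨Z, hZ, rfl⟩
    obtain ⟨μ, hμ⟩ := mem_nomuraPair.1 hZ
    refine mem_nomuraPair.2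
      -- Replacing column $j$ of $W$ by its partner in the other half negates the upper part of the
      -- eigenvector and keeps the lower part. Half the difference of the two equations involves
      -- only the upper left block and averages the eigenvalues.
      ⟨Matrix.of fun i j => (μ (.inl i) (.inl j) + μ (.inl i) (.inr j)) / 2, fun i j x => ?_⟩
    have h1 := hμ (.inl i) (.inl j) (.inl x)
    have h2 := hμ (.inl i) (.inr j) (.inl x)
    simp only [matrixW, Fintype.sum_sum_type, schurInv_apply, fromBlocks_apply₁₁,
      fromBlocks_apply₁₂, fromBlocks_apply₂₁, fromBlocks_apply₂₂, Matrix.neg_apply, inv_neg,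
      mul_neg, Finset.sum_neg_distrib] at h1 h2
    change ∑ k, Z (.inl x) (.inl k) * (Aᵀ k i * (Aᵀ k j)⁻¹) =
      (μ (.inl i) (.inl j) + μ (.inl i) (.inr j)) / 2 * (Aᵀ x i * (Aᵀ x j)⁻¹)
    linear_combination (h1 - h2) / 2
  · intro P hP
    obtain ⟨μ, hμ⟩ := mem_nomuraPair.1 hP
    obtain ⟨S, hS⟩ := exists_hasEigenmatrix_of_nomura_le hA hB hle hμ
    have hS' : HasEigenmatrix ((schurInv B)ᵀ * diagonal c)
        (schurInv ((schurInv B)ᵀ * diagonal c)) S μ :=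
      hS.scale (s := fun _ => 1) (t := c) (fun _ => one_ne_zero) fun x i => by
        rw [mul_diagonal, one_mul]
    -- Every eigenvector for $W$ has upper part $\pm$ an eigenvector of $P$ and lower part an
    -- eigenvector of $S$. Both have the eigenvalue $\mu_{ij}$, so the signs do not matter and all
    -- four blocks equal $\mu$.
    refine ⟨fromBlocks P 0 0 S, mem_nomuraPair.2 ⟨fromBlocks μ μ μ μ, ?_⟩, ?_⟩
    · rintro (i | i) (j | j) (x | x) <;>
      have h1 := hμ i j x <;> have h2 := hS' i j x <;>
      simp only [schurInv_apply] at h1 h2 <;>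
      simp only [matrixW, Fintype.sum_sum_type, schurInv_apply, fromBlocks_apply₁₁,
        fromBlocks_apply₁₂, fromBlocks_apply₂₁, fromBlocks_apply₂₂, Matrix.neg_apply, inv_neg,
        mul_neg, neg_mul, neg_neg, Finset.sum_neg_distrib, Matrix.zero_apply, zero_mul,
        Finset.sum_const_zero, neg_zero, add_zero, zero_add, h1, h2]
    · rfl

end JonesPair

end JonesPairs

theorem mainTheorem8 (n : ℕ) (hn : 0 < n) (A B : Matrix (Fin n) (Fin n) ℂ)
    (hAB : JonesPairs.IsInvertibleJonesPair A B) :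
    (∃ c : Fin n → ℂ, JonesPairs.IsSymmetrizer A c) ∧
    ∀ c : Fin n → ℂ, JonesPairs.IsSymmetrizer A c →
      ∃ (𝒜 : Finset (Matrix (Fin n ⊕ Fin n) (Fin n ⊕ Fin n) ℂ))
        (ℬ : Finset (Matrix (Fin n) (Fin n) ℂ)),
        JonesPairs.IsSchemeOf 𝒜 (JonesPairs.nomura (JonesPairs.matrixW A B c)) ∧
        JonesPairs.IsSchemeOf ℬ (JonesPairs.nomura A) ∧
        JonesPairs.IsInducedScheme Function.Embedding.inl ℬ 𝒜 := by
  have : Nonempty (Fin n) := ⟨⟨0, hn⟩⟩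
  have h := hAB.isJonesPair.1.hasEigenmatrix
  have hA := h.isTypeII_left hAB.isUnit_left hAB.isUnit_right hAB.schurInvertible_right
  have hB := h.isTypeII_right hA.1 hAB.isUnit_right
  refine ⟨h.exists_isSymmetrizer hA.1 hAB.isUnit_right, fun c hc => ?_⟩
  obtain ⟨𝒜, h𝒜⟩ :=
    (JonesPairs.isBoseMesner_nomura (JonesPairs.isTypeII_matrixW hA hB hc.1)).exists_isSchemeOf
  have hmap := (JonesPairs.map_restrictLinear_nomura_matrixW (c := c) hA hB
    (h.nomura_le hA hB.1)).trans (JonesPairs.nomura_transpose hc)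
  have hℬ := h𝒜.restrictScheme Function.Embedding.inl
    (hmap ▸ JonesPairs.isBoseMesner_nomura hA)
  rw [hmap] at hℬ
  exact ⟨𝒜, _, h𝒜, hℬ, this, h𝒜.1, hℬ.1, rfl⟩
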